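/- There is a universal constant $\kappa>0$ such that the following holds. Let $\mathcal X,\mathcal Y$ be finite sets, let $f:\mathcal X\times\mathcal Y\to\{0,1\}$ be a boolean function, let $\mu$ be any probability distribution on $\mathcal X\times\mathcal Y$ (possibly non-product), let $(X,Y)$ be distributed according to $\mu$, and let $\epsilon\in(0,1/2)$. Then $$\mathsf D^{1,\mu}_\epsilon(f)\;\le\;\kappa\cdot\frac1\epsilon\log\frac1\epsilon\cdot\Bigl(\frac1\epsilon\cdot I(X:Y)+1\Bigr)\cdot \mathsf{VC}(f).$$ In particular, for every constant $\epsilon\in(0,1/2)$ one has $\mathsf D^{1,\mu}_\epsilon(f)=O\bigl((I(X:Y)+1)\cdot\mathsf{VC}(f)\bigr)$, that is, there is a constant $C_\epsilon>0$ depending only on $\epsilon$ such that $\mathsf D^{1,\mu}_\epsilon(f)\le C_\epsilon\,(I(X:Y)+1)\,\mathsf{VC}(f)$ for all finite $\mathcal X,\mathcal Y$, all $f$ and all $\mu$ as above. Here all logarithms are to base $2$, and: - $\mathsf D^{1,\mu}_\epsilon(f)$ is the one-way distributional communication complexity: the least number $c$ of bits for which there is a deterministic one-way protocol (Alice, given $x$,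 sends a message $m(x)\in\{0,1\}^c$, and Bob, given $y$, outputs a bit $b(m(x),y)$) with $\Pr_{(x,y)\sim\mu}[b(m(x),y)\ne f(x,y)]\le\epsilon$; - $I(X:Y)=S(X)+S(Y)-S(XY)$ is the mutual information, where $S(Z)=-\sum_z\Pr[Z=z]\log\Pr[Z=z]$ is the Shannon entropy; - $\mathsf{VC}(f)$ is the Vapnik–Chervonenkis dimension of the family $\{f_x:x\in\mathcal X\}$, $f_x(y)=f(x,y)$, i.e. the largest size of a set $S\subseteq\mathcal Y$ such that for each $R\subseteq S$ there is an $x\in\mathcal X$ with $R=\{s\in S: f_x(s)=1\}$. -/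

import Mathlib

universe u v

namespace OneWayCC

/-- The family of all rows `f_x : Y → {0,1}` of `f : X × Y → {0,1}`, where a row is written as the
set of the points of `Y` at which it takes the value `1`. -/
def rowFamily {X Y : Type*} [Fintype X] [Fintype Y] [DecidableEq Y] (f : X × Y → Bool) :
    Finset (Finset Y) :=
  Finset.univ.image fun x => Finset.univ.filter fun y => f (x, y) = true

/-- The VC dimension of `f`: the largest size of a subset of `Y` shattered by the rows of `f`. -/
def vcDimension {X Y : Type*} [Fintype X] [Fintype Y] [DecidableEq Y] (f : X × Y → Bool) : ℕ :=
  (rowFamily f).vcDim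

/-- Shannon entropy, in bits, of the distribution on a finite set with probabilities `p a`. -/
noncomputable def entropy {A : Type*} [Fintype A] (p : A → ℝ) : ℝ :=
  -∑ a, p a * Real.logb 2 (p a)

/-- The mutual information `I(X:Y) = S(X) + S(Y) - S(XY)`, in bits, of a pair of random variables
with joint distribution `μ`. -/
noncomputable def mutualInfo {X Y : Type*} [Fintype X] [Fintype Y] (μ : X × Y → ℝ) : ℝ :=
  entropy (fun x => ∑ y, μ (x, y)) + entropy (fun y => ∑ x, μ (x, y)) - entropy μ

/-- A deterministic one-way protocol with `c` bits of communication and boolean output: Alice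
sends a message of `c` bits that depends on her input, and Bob computes the output from the message
and his input. -/
structure Protocol (X Y : Type*) (c : ℕ) where
  message : X → (Fin c → Bool)
  output : (Fin c → Bool) → Y → Bool

/-- The distributional error of a protocol for `f` under `μ`. -/
def Protocol.error {X Y : Type*} [Fintype X] [Fintype Y] {c : ℕ} (P : Protocol X Y c)
    (f : X × Y → Bool) (μ : X × Y → ℝ) : ℝ :=
  ∑ p : X × Y with P.output (P.message p.1) p.2 ≠ f p, μ p

/-- The one-way distributional communication complexity of `f` under `μ` with error `ε`: the least
number of bits of a deterministic one-way protocol for `f` with distributional error at most `ε`.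
For `0 ≤ ε` such protocols exist, see `exists_protocol_complexity`. -/
noncomputable def complexity {X Y : Type*} [Fintype X] [Fintype Y] (ε : ℝ)
    (μ : X × Y → ℝ) (f : X × Y → Bool) : ℕ :=
  sInf {c : ℕ | ∃ P : Protocol X Y c, P.error f μ ≤ ε}

/-- The minimum in the definition of `complexity` is over a nonempty set, and so it is attained. -/
theorem exists_protocol_complexity {X Y : Type*} [Fintype X] [Fintype Y] {ε : ℝ} (hε : 0 ≤ ε)
    (μ : X × Y → ℝ) (f : X × Y → Bool) :
    ∃ P : Protocol X Y (complexity ε μ f), P.error f μ ≤ ε := by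
  classical
  refine Nat.sInf_mem (s := {c : ℕ | ∃ P : Protocol X Y c, P.error f μ ≤ ε}) ?_
  let e := Fintype.equivFin X
  refine ⟨Fintype.card X, ⟨fun x i => decide (e x = i),
    fun m y => decide (∃ x, m (e x) = true ∧ f (x, y) = true)⟩, ?_⟩
  have h : (Finset.univ.filter fun p : X × Y =>
      decide (∃ x, decide (e p.1 = e x) = true ∧ f (x, p.2) = true) ≠ f p) = ∅ := by
    ext ⟨x, y⟩
    simp
  unfold Protocol.error
  simp only [h, Finset.sum_empty]
  exact hε

end OneWayCC

/-! Under the marginal of `μ` on `Y`, the rows of `f` have a `2^(-n)`-net whose size is exponential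
in `n` times the VC dimension (`exists_net`). Alice names a net member close to her row, and Bob
evaluates it. The resulting error set has measure at most `2^(-n)` under the product of the
marginals, not yet under `μ`. The change of measure is `mul_sum_le_mutualInfo_add_one`, an instance
of the variational (Donsker–Varadhan) bound: an event of product measure `2^(-t)` has `μ`-measure at
most `(I + 1) / t`. With `t = (I + 1) / ε` and `n = ⌈t⌉` the error is at most `ε`, and the cost is
linear in `t` times the VC dimension, without a logarithmic factor. -/

namespace OneWayCC

open Finset

/-! ### Mutual information and change of measure -/

/-- Gibbs' inequality. -/
lemma sum_mul_logb_le_sum_mul_logb {A : Type*} [Fintype A] {p q : A → ℝ} (hp : ∀ a, 0 ≤ p a)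
    (hq : ∀ a, 0 ≤ q a) (hac : ∀ a, q a = 0 → p a = 0) (hsum : ∑ a, q a ≤ ∑ a, p a) :
    ∑ a, p a * Real.logb 2 (q a) ≤ ∑ a, p a * Real.logb 2 (p a) := by
  -- The bound `log s ≤ s - 1` at `s = q a / p a`, multiplied by `p a`. The corrections `q a - p a`
  -- sum to at most zero.
  have key : ∀ a, p a * Real.log (q a) ≤ p a * Real.log (p a) + (q a - p a) := by
    intro a
    rcases (hp a).eq_or_lt with h0 | hpa
    · rw [← h0]
      simpa using hq a
    · have hqa : 0 < q a := (hq a).lt_of_ne fun h => hpa.ne' (hac a h.symm)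
      have h1 := Real.log_le_sub_one_of_pos (div_pos hqa hpa)
      rw [Real.log_div hqa.ne' hpa.ne'] at h1
      have h2 := mul_le_mul_of_nonneg_left h1 hpa.le
      have h3 : p a * (q a / p a - 1) = q a - p a := by field_simp
      rw [h3] at h2
      linarith
  have h2 : 0 < Real.log 2 := Real.log_pos (by norm_num)
  simp only [Real.logb, mul_div_assoc', ← Finset.sum_div]
  refine div_le_div_of_nonneg_right ?_ h2.le
  have h := Finset.sum_le_sum fun a (_ : a ∈ Finset.univ) => key a
  rw [Finset.sum_add_distrib, Finset.sum_sub_distrib] at h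
  linarith

section Information

variable {X Y : Type*} [Fintype X] [Fintype Y] {μ : X × Y → ℝ}

lemma sum_fst_marginal (μ : X × Y → ℝ) : ∑ x, ∑ y, μ (x, y) = ∑ z, μ z :=
  (Fintype.sum_prod_type μ).symm

lemma sum_snd_marginal (μ : X × Y → ℝ) : ∑ y, ∑ x, μ (x, y) = ∑ z, μ z :=
  (Fintype.sum_prod_type_right μ).symm

/-- The product of the marginals has total mass one. -/
lemma sum_marginal_mul_marginal (hμ : μ ∈ stdSimplex ℝ (X × Y)) :
    ∑ z : X × Y, (∑ y, μ (z.1, y)) * (∑ x, μ (x, z.2)) = 1 := by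
  rw [Fintype.sum_prod_type]
  simp only [← Finset.mul_sum, ← Finset.sum_mul]
  rw [sum_fst_marginal, sum_snd_marginal, hμ.2, one_mul]

/-- The variational lower bound on mutual information: `I(X:Y) ≥ E_μ[φ]` whenever the expectation
of `2^φ` under the product of the marginals is at most one. -/
lemma sum_mul_le_mutualInfo (hμ : μ ∈ stdSimplex ℝ (X × Y)) (φ : X × Y → ℝ)
    (hφ : ∑ z : X × Y, (∑ y, μ (z.1, y)) * (∑ x, μ (x, z.2)) * (2 : ℝ) ^ φ z ≤ 1) :
    ∑ z, μ z * φ z ≤ mutualInfo μ := by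
  classical
  have hle1 : ∀ z : X × Y, μ z ≤ ∑ y, μ (z.1, y) := fun z =>
    Finset.single_le_sum (f := fun y => μ (z.1, y)) (fun y _ => hμ.1 _) (Finset.mem_univ z.2)
  have hle2 : ∀ z : X × Y, μ z ≤ ∑ x, μ (x, z.2) := fun z =>
    Finset.single_le_sum (f := fun x => μ (x, z.2)) (fun x _ => hμ.1 _) (Finset.mem_univ z.1)
  have h2 : ∀ z, (0 : ℝ) < 2 ^ φ z := fun z => Real.rpow_pos_of_pos (by norm_num) _
  -- Gibbs' inequality against the product of the marginals tilted by `2^φ`. A zero marginal forces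
  -- `μ` to vanish there.
  have hG := sum_mul_logb_le_sum_mul_logb (p := μ)
    (q := fun z => (∑ y, μ (z.1, y)) * (∑ x, μ (x, z.2)) * (2 : ℝ) ^ φ z) hμ.1
    (fun z => mul_nonneg (mul_nonneg ((hμ.1 z).trans (hle1 z)) ((hμ.1 z).trans (hle2 z))) (h2 z).le)
    (fun z hz => by
      rcases mul_eq_zero.1 hz with h | h
      · rcases mul_eq_zero.1 h with h | h
        · exact le_antisymm (h ▸ hle1 z) (hμ.1 z)
        · exact le_antisymm (h ▸ hle2 z) (hμ.1 z)
      · exact absurd h (h2 z).ne')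
    (by rw [hμ.2]; exact hφ)
  have hterm : ∀ z : X × Y,
      μ z * Real.logb 2 ((∑ y, μ (z.1, y)) * (∑ x, μ (x, z.2)) * (2 : ℝ) ^ φ z) =
        μ z * Real.logb 2 (∑ y, μ (z.1, y)) + μ z * Real.logb 2 (∑ x, μ (x, z.2)) + μ z * φ z := by
    intro z
    rcases (hμ.1 z).eq_or_lt with h0 | h0
    · simp [← h0]
    · have p1 := h0.trans_le (hle1 z)
      have p2 := h0.trans_le (hle2 z)
      rw [Real.logb_mul (mul_pos p1 p2).ne' (h2 z).ne', Real.logb_mul p1.ne' p2.ne',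
        Real.logb_rpow (by norm_num) (by norm_num)]
      ring
  simp only [hterm, Finset.sum_add_distrib] at hG
  have e1 : ∑ z : X × Y, μ z * Real.logb 2 (∑ y, μ (z.1, y)) =
      ∑ x, (∑ y, μ (x, y)) * Real.logb 2 (∑ y, μ (x, y)) := by
    rw [Fintype.sum_prod_type]
    simp only [Finset.sum_mul]
  have e2 : ∑ z : X × Y, μ z * Real.logb 2 (∑ x, μ (x, z.2)) =
      ∑ y, (∑ x, μ (x, y)) * Real.logb 2 (∑ x, μ (x, y)) := by
    rw [Fintype.sum_prod_type_right]
    simp only [Finset.sum_mul]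
  rw [e1, e2] at hG
  unfold mutualInfo entropy
  linarith

lemma mutualInfo_nonneg (hμ : μ ∈ stdSimplex ℝ (X × Y)) : 0 ≤ mutualInfo μ := by
  simpa using sum_mul_le_mutualInfo hμ 0 (by simp [sum_marginal_mul_marginal hμ])

/-- An event of probability at most `2^(-t)` under the product of the marginals has probability at
most `(I(X:Y) + 1) / t` under the joint distribution. -/
lemma mul_sum_le_mutualInfo_add_one (hμ : μ ∈ stdSimplex ℝ (X × Y)) (B : Finset (X × Y)) (t : ℝ)
    (hB : ∑ z ∈ B, (∑ y, μ (z.1, y)) * (∑ x, μ (x, z.2)) ≤ (2 : ℝ) ^ (-t)) :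
    t * ∑ z ∈ B, μ z ≤ mutualInfo μ + 1 := by
  classical
  have hpos : ∀ z : X × Y, 0 ≤ (∑ y, μ (z.1, y)) * (∑ x, μ (x, z.2)) := fun z =>
    mul_nonneg (Finset.sum_nonneg fun _ _ => hμ.1 _) (Finset.sum_nonneg fun _ _ => hμ.1 _)
  -- The shift by `-1` halves all weights: the whole space then contributes at most `1/2`, and the
  -- factor `2^t` on `B` at most another `1/2`.
  have h := sum_mul_le_mutualInfo hμ (fun z => (if z ∈ B then t else 0) - 1) ?_
  · simp only [mul_sub, mul_one, mul_ite, mul_zero, Finset.sum_sub_distrib, hμ.2,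
      Finset.sum_ite_mem, Finset.univ_inter, ← Finset.sum_mul] at h
    linarith
  · have hterm : ∀ z : X × Y, (∑ y, μ (z.1, y)) * (∑ x, μ (x, z.2)) *
        (2 : ℝ) ^ ((if z ∈ B then t else 0) - 1) ≤
        (∑ y, μ (z.1, y)) * (∑ x, μ (x, z.2)) / 2 +
          if z ∈ B then (∑ y, μ (z.1, y)) * (∑ x, μ (x, z.2)) * ((2 : ℝ) ^ t / 2) else 0 := by
      intro z
      rw [Real.rpow_sub (by norm_num), Real.rpow_one]
      split_ifs
      · linarith [hpos z]
      · rw [Real.rpow_zero]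
        linarith [hpos z]
    refine (Finset.sum_le_sum fun z _ => hterm z).trans ?_
    rw [Finset.sum_add_distrib, ← Finset.sum_div, sum_marginal_mul_marginal hμ,
      Finset.sum_ite_mem, Finset.univ_inter, ← Finset.sum_mul]
    have ht : (0 : ℝ) < 2 ^ t := Real.rpow_pos_of_pos (by norm_num) _
    have := mul_le_mul_of_nonneg_right hB (half_pos ht).le
    rw [Real.rpow_neg (by norm_num)] at this
    have e : ((2 : ℝ) ^ t)⁻¹ * (2 ^ t / 2) = 1 / 2 := by field_simp
    linarith

end Information

/-! ### Separated families and nets in bounded VC dimension -/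

section Covering

/-- A set of size at most `d * k` has at most `(4 * k) ^ d` subsets of size at most `d`. -/
lemma card_filter_powerset_card_le {α : Type*} (S : Finset α) {d k : ℕ} (hk : 1 ≤ k)
    (hS : #S ≤ d * k) :
    #{U ∈ S.powerset | #U ≤ d} ≤ (4 * k) ^ d := by
  have hk0 : (1 : ℝ) ≤ k := by exact_mod_cast hk
  have hkpos : (0 : ℝ) < k := by linarith
  -- Give `U` the weight `k^(-#U)`, which is at least `k^(-d)` on the sets counted; over all subsets
  -- of `S` the weights sum to `(1 + 1/k)^#S`.
  have h1 : ((1 : ℝ) / k) ^ d * #{U ∈ S.powerset | #U ≤ d} ≤ (1 / k + 1) ^ #S := by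
    rw [← Finset.sum_pow_mul_eq_add_pow, mul_comm, ← nsmul_eq_mul, ← Finset.sum_const]
    refine (Finset.sum_le_sum fun U hU => ?_).trans
      (Finset.sum_le_sum_of_subset_of_nonneg (Finset.filter_subset _ _) fun U _ _ => by positivity)
    rw [one_pow, mul_one]
    exact pow_le_pow_of_le_one (by positivity) ((div_le_one hkpos).2 hk0) (Finset.mem_filter.1 hU).2
  have h2 : ((1 : ℝ) / k + 1) ^ #S ≤ 4 ^ d := by
    calc ((1 : ℝ) / k + 1) ^ #S ≤ (1 / k + 1) ^ (d * k) :=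
          pow_le_pow_right₀ (by linarith [show (0 : ℝ) < 1 / k by positivity]) hS
      _ ≤ Real.exp (1 / k) ^ (d * k) := by
          gcongr
          exact Real.add_one_le_exp _
      _ = Real.exp 1 ^ d := by
          rw [← Real.exp_nat_mul, ← Real.exp_nat_mul]
          congr 1
          push_cast
          field_simp
      _ ≤ 4 ^ d := by
          gcongr
          linarith [Real.exp_one_lt_d9]
  have h3 := h1.trans h2
  rw [div_pow, one_pow, div_mul_eq_mul_div, one_mul, div_le_iff₀ (by positivity), ← mul_pow] at h3
  exact_mod_cast h3

variable {Y : Type*} [DecidableEq Y]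

/-- The Sauer–Shelah bound for the traces on a set `S` of a family that `S` separates. -/
lemma card_le_of_injOn_inter {F : Finset (Finset Y)} {S : Finset Y} {d k : ℕ} (hF : F.vcDim ≤ d)
    (hk : 1 ≤ k) (hS : #S ≤ d * k) (hinj : Set.InjOn (fun g => S ∩ g) (F : Set (Finset Y))) :
    #F ≤ (4 * k) ^ d := by
  rw [← Finset.card_image_of_injOn hinj]
  -- Pajor's form of Sauer–Shelah: a family shatters at least as many sets as it has members. A set
  -- shattered by the traces lies in `S` and is shattered by `F`.
  refine (Finset.card_le_card_shatterer _).trans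
    ((Finset.card_le_card fun U hU => ?_).trans (card_filter_powerset_card_le S hk hS))
  rw [Finset.mem_shatterer] at hU
  have hUS : U ⊆ S := by
    obtain ⟨T, hT, hUT⟩ := hU (Finset.Subset.refl U)
    obtain ⟨g, -, rfl⟩ := Finset.mem_image.1 hT
    rw [← hUT]
    exact Finset.inter_subset_right.trans Finset.inter_subset_left
  rw [Finset.mem_filter, Finset.mem_powerset]
  refine ⟨hUS, le_trans (Finset.Shatters.card_le_vcDim fun R hR => ?_) hF⟩
  obtain ⟨T, hT, hUT⟩ := hU hR
  obtain ⟨g, hg, rfl⟩ := Finset.mem_image.1 hT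
  refine ⟨g, hg, ?_⟩
  rw [← hUT, ← Finset.inter_assoc, Finset.inter_eq_left.2 hUS]

variable [Fintype Y]

/-- Greedy hitting sets: if all sets indexed by `P` have probability at least `δ`, then `m` points
hit all but a `(1 - δ)^m` fraction of them. -/
lemma exists_card_le_card_filter_disjoint_le {ι : Type*} {ν : Y → ℝ} (hν : ν ∈ stdSimplex ℝ Y)
    {δ : ℝ} (hδ : δ ≤ 1) (D : ι → Finset Y) (P : Finset ι) (hP : ∀ i ∈ P, δ ≤ ∑ y ∈ D i, ν y)
    (m : ℕ) :
    ∃ S : Finset Y, #S ≤ m ∧ (#{i ∈ P | Disjoint (D i) S} : ℝ) ≤ #P * (1 - δ) ^ m := by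
  induction m with
  | zero => exact ⟨∅, by simp⟩
  | succ m ih =>
    obtain ⟨S, hS, hcard⟩ := ih
    set Q := {i ∈ P | Disjoint (D i) S} with hQ
    -- Averaging: a `ν`-random point misses each set with probability at most `1 - δ`, so some point
    -- leaves at most that fraction unhit.
    have hsum : ∑ y, ν y * #{i ∈ Q | y ∉ D i} ≤ ∑ y, ν y * (#Q * (1 - δ)) := by
      rw [← Finset.sum_mul, hν.2, one_mul]
      calc ∑ y, ν y * #{i ∈ Q | y ∉ D i} = ∑ y, ∑ i ∈ Q, if y ∉ D i then ν y else 0 := by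
            refine Finset.sum_congr rfl fun y _ => ?_
            rw [← Finset.sum_filter, Finset.sum_const, nsmul_eq_mul, mul_comm]
        _ = ∑ i ∈ Q, (1 - ∑ y ∈ D i, ν y) := by
            rw [Finset.sum_comm]
            refine Finset.sum_congr rfl fun i _ => ?_
            rw [← hν.2, ← Finset.sum_filter, eq_sub_iff_add_eq, add_comm]
            have h := Finset.sum_filter_add_sum_filter_not Finset.univ (fun y => y ∈ D i) ν
            rwa [Finset.filter_univ_mem] at h
        _ ≤ ∑ i ∈ Q, (1 - δ) :=
            Finset.sum_le_sum fun i hi => by linarith [hP i (Finset.mem_filter.1 hi).1]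
        _ = #Q * (1 - δ) := by rw [Finset.sum_const, nsmul_eq_mul]
    obtain ⟨y, hy⟩ : ∃ y, (#{i ∈ Q | y ∉ D i} : ℝ) ≤ #Q * (1 - δ) := by
      by_contra! hcon
      have hne : ∃ y, 0 < ν y := by
        by_contra! hneg
        have := Finset.sum_nonpos fun y (_ : y ∈ Finset.univ) => hneg y
        rw [hν.2] at this
        linarith
      obtain ⟨y₀, hy₀⟩ := hne
      refine absurd hsum (not_le.2 (Finset.sum_lt_sum
        (fun y _ => mul_le_mul_of_nonneg_left (hcon y).le (hν.1 y))
        ⟨y₀, Finset.mem_univ _, mul_lt_mul_of_pos_left (hcon y₀) hy₀⟩))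
    refine ⟨insert y S, (Finset.card_insert_le _ _).trans (by omega), ?_⟩
    have hset : {i ∈ P | Disjoint (D i) (insert y S)} = {i ∈ Q | y ∉ D i} := by
      ext i
      simp only [hQ, Finset.mem_filter, Finset.disjoint_insert_right]
      tauto
    rw [hset]
    calc (#{i ∈ Q | y ∉ D i} : ℝ) ≤ #Q * (1 - δ) := hy
      _ ≤ #P * (1 - δ) ^ m * (1 - δ) := mul_le_mul_of_nonneg_right hcard (by linarith)
      _ = #P * (1 - δ) ^ (m + 1) := by ring

/-- The term `z^6 / 720` of the exponential series suffices, as `64^3 > 64 * 720`. With `z = 4^n`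
the left side is `(8 * 8^n)^2`, whose `d`-th power bounds the number of pairs in
`card_le_of_pairwise_le`. -/
lemma mul_pow_three_lt_exp {z : ℝ} (hz : 64 ≤ z) : 64 * z ^ 3 < Real.exp z := by
  have h := Real.pow_div_factorial_le_exp z (by linarith) 6
  have h6 : ((Nat.factorial 6 : ℕ) : ℝ) = 720 := by norm_num [Nat.factorial]
  rw [h6] at h
  refine lt_of_lt_of_le ?_ h
  have h3 : (64 : ℝ) ^ 3 ≤ z ^ 3 := by gcongr
  rw [lt_div_iff₀ (by norm_num)]
  nlinarith

/-- Dudley's bound on separated families: a family of VC dimension at most `d` whose members have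
pairwise distance at least `2^(-n)` has at most `(4 * 8^n) ^ d` members. -/
lemma card_le_of_pairwise_le {ν : Y → ℝ} (hν : ν ∈ stdSimplex ℝ Y) {F : Finset (Finset Y)}
    {d n : ℕ} (hd : 1 ≤ d) (hn : 3 ≤ n) (hF : F.vcDim ≤ d)
    (hsep : (F : Set (Finset Y)).Pairwise fun g h => (1 / 2 : ℝ) ^ n ≤ ∑ y ∈ symmDiff g h, ν y) :
    #F ≤ (4 * 8 ^ n) ^ d := by
  by_contra! hlt
  -- Trimming to one member too many keeps the number of pairs bounded.
  obtain ⟨G, hGF, hG⟩ := Finset.exists_subset_card_eq (Nat.succ_le_of_lt hlt)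
  have hGd : G.vcDim ≤ d := (Finset.vcDim_mono hGF).trans hF
  -- With `d * k` points, the unhit fraction of the differences is at most `exp (-4^n)^d`, which
  -- beats the number of pairs. The points then separate `G`, contradicting Sauer–Shelah.
  set k : ℕ := 8 ^ n with hk
  have hk1 : 1 ≤ k := Nat.one_le_pow _ _ (by norm_num)
  have hδ : (1 / 2 : ℝ) ^ n ≤ 1 := pow_le_one₀ (by norm_num) (by norm_num)
  obtain ⟨S, hS, hcard⟩ := exists_card_le_card_filter_disjoint_le hν hδ
    (fun p : Finset Y × Finset Y => symmDiff p.1 p.2) G.offDiag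
    (fun p hp => by
      obtain ⟨h1, h2, h3⟩ := Finset.mem_offDiag.1 hp
      exact hsep (hGF h1) (hGF h2) h3) (d * k)
  have hbound : (#G.offDiag : ℝ) * (1 - (1 / 2) ^ n) ^ (d * k) < 1 := by
    have hM : (#G : ℝ) ≤ (8 * 8 ^ n) ^ d := by
      have : #G ≤ (8 * 8 ^ n) ^ d := by
        rw [hG, Nat.succ_le_iff]
        exact Nat.pow_lt_pow_left (by omega) (by omega)
      exact_mod_cast this
    have h1 : (#G.offDiag : ℝ) ≤ ((8 * 8 ^ n) ^ 2) ^ d := by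
      have : (#G.offDiag : ℝ) ≤ (#G : ℝ) ^ 2 := by
        rw [Finset.offDiag_card, sq]
        exact_mod_cast Nat.sub_le _ _
      rw [pow_right_comm]
      exact this.trans (by gcongr)
    have h2 : (1 - (1 / 2 : ℝ) ^ n) ^ (d * k) ≤ (Real.exp (-4 ^ n)) ^ d := by
      rw [mul_comm d k, pow_mul]
      refine pow_le_pow_left₀ (pow_nonneg (by linarith) _) ?_ _
      calc (1 - (1 / 2 : ℝ) ^ n) ^ k ≤ Real.exp (-(1 / 2) ^ n) ^ k :=
            pow_le_pow_left₀ (by linarith) (Real.one_sub_le_exp_neg _) _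
        _ = Real.exp (-4 ^ n) := by
            rw [← Real.exp_nat_mul, hk]
            congr 1
            push_cast
            rw [mul_neg, ← mul_pow]
            norm_num
    calc (#G.offDiag : ℝ) * (1 - (1 / 2) ^ n) ^ (d * k)
        ≤ ((8 * 8 ^ n) ^ 2) ^ d * (Real.exp (-4 ^ n)) ^ d :=
          mul_le_mul h1 h2 (pow_nonneg (by linarith) _) (by positivity)
      _ = ((8 * 8 ^ n) ^ 2 * Real.exp (-4 ^ n)) ^ d := (mul_pow _ _ _).symm
      _ < 1 := by
          refine pow_lt_one₀ (by positivity) ?_ (by omega)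
          rw [Real.exp_neg, ← div_eq_mul_inv, div_lt_one (Real.exp_pos _)]
          have hz : (64 : ℝ) ≤ 4 ^ n := by
            calc (64 : ℝ) = 4 ^ 3 := by norm_num
              _ ≤ 4 ^ n := pow_le_pow_right₀ (by norm_num) hn
          have := mul_pow_three_lt_exp hz
          have e : ((8 : ℝ) * 8 ^ n) ^ 2 = 64 * (4 ^ n) ^ 3 := by
            rw [mul_pow, ← pow_mul, ← pow_mul, mul_comm n 2, mul_comm n 3, pow_mul, pow_mul]
            norm_num
          rwa [e]
  have hzero : #{p ∈ G.offDiag | Disjoint (symmDiff p.1 p.2) S} = 0 := by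
    have := hcard.trans_lt hbound
    exact Nat.lt_one_iff.1 (by exact_mod_cast this)
  rw [Finset.card_eq_zero, Finset.filter_eq_empty_iff] at hzero
  have hinj : Set.InjOn (fun g => S ∩ g) (G : Set (Finset Y)) := by
    intro g hg h hh hgh
    by_contra hne
    refine hzero (x := (g, h)) (Finset.mem_offDiag.2 ⟨hg, hh, hne⟩) ?_
    rw [Finset.disjoint_left]
    intro y hy hyS
    have := Finset.ext_iff.1 hgh y
    simp only [Finset.mem_inter, hyS, true_and] at this
    rw [Finset.mem_symmDiff] at hy
    tauto
  have := card_le_of_injOn_inter hGd hk1 hS hinj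
  omega

/-- Every family of VC dimension at most `d` has a `2^(-n)`-net of at most `(4 * 8^n) ^ d`
members. -/
lemma exists_net {ν : Y → ℝ} (hν : ν ∈ stdSimplex ℝ Y) {F : Finset (Finset Y)}
    {d n : ℕ} (hd : 1 ≤ d) (hn : 3 ≤ n) (hF : F.vcDim ≤ d) :
    ∃ G : Finset (Finset Y), #G ≤ (4 * 8 ^ n) ^ d ∧
      ∀ g ∈ F, ∃ h ∈ G, ∑ y ∈ symmDiff g h, ν y ≤ (1 / 2 : ℝ) ^ n := by
  classical
  -- A separated subfamily of maximal size is a net: any row far from it could be added.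
  obtain ⟨G, hG, hmax⟩ := Finset.exists_max_image
    (F.powerset.filter fun G : Finset (Finset Y) => (G : Set (Finset Y)).Pairwise
      fun g h => (1 / 2 : ℝ) ^ n ≤ ∑ y ∈ symmDiff g h, ν y) (fun G => #G) ⟨∅, by simp⟩
  rw [Finset.mem_filter, Finset.mem_powerset] at hG
  refine ⟨G, card_le_of_pairwise_le hν hd hn ((Finset.vcDim_mono hG.1).trans hF) hG.2,
    fun g hg => ?_⟩
  by_contra! hcon
  have hgG : g ∉ G := fun h => by
    have := hcon g h
    rw [symmDiff_self] at this
    exact absurd this (not_lt.2 (by simp))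
  have := hmax (insert g G) (by
    rw [Finset.mem_filter, Finset.mem_powerset, Finset.coe_insert]
    refine ⟨Finset.insert_subset hg hG.1, hG.2.insert fun h hh _ => ⟨(hcon h hh).le, ?_⟩⟩
    rw [symmDiff_comm]
    exact (hcon h hh).le)
  rw [Finset.card_insert_of_notMem hgG] at this
  omega

end Covering

/-! ### From nets to one-way protocols -/

section Protocols

variable {X Y : Type*} [Fintype X] [Fintype Y]

lemma complexity_le {ε : ℝ} {μ : X × Y → ℝ} {f : X × Y → Bool} {c : ℕ} (P : Protocol X Y c)
    (hP : P.error f μ ≤ ε) : complexity ε μ f ≤ c :=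
  Nat.sInf_le ⟨P, hP⟩

variable [DecidableEq Y]

/-- If no singleton is shattered, `f (x, y)` does not depend on `x`, and Bob needs no message. This
case is separate because `exists_net` needs `1 ≤ d`. -/
lemma complexity_eq_zero_of_vcDimension_eq_zero {ε : ℝ} (hε : 0 ≤ ε) (μ : X × Y → ℝ)
    (f : X × Y → Bool) (hf : vcDimension f = 0) : complexity ε μ f = 0 := by
  classical
  have hrow : ∀ x x' y, f (x, y) = true → f (x', y) = true := by
    intro x x' y hx
    by_contra hx'
    have hsh : (rowFamily f).Shatters {y} := by
      intro R hR
      rcases Finset.subset_singleton_iff.1 hR with rfl | rfl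
      · refine ⟨_, Finset.mem_image_of_mem _ (Finset.mem_univ x'), ?_⟩
        rw [Finset.singleton_inter_of_notMem (by simpa using hx')]
      · refine ⟨_, Finset.mem_image_of_mem _ (Finset.mem_univ x), ?_⟩
        rw [Finset.singleton_inter_of_mem (by simpa using hx)]
    have := hsh.card_le_vcDim
    rw [Finset.card_singleton] at this
    unfold vcDimension at hf
    omega
  refine Nat.le_zero.1 (complexity_le (c := 0)
    ⟨fun _ => Fin.elim0, fun _ y => decide (∃ x, f (x, y) = true)⟩ ?_)
  unfold Protocol.error
  rw [Finset.filter_false_of_mem, Finset.sum_empty]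
  · exact hε
  · rintro ⟨x, y⟩ -
    rw [not_not, Bool.eq_iff_iff, decide_eq_true_iff]
    exact ⟨fun ⟨x', h⟩ => hrow x' x y h, fun h => ⟨x, h⟩⟩

/-- If every row of `f` is `δ`-close, under the marginal on `Y`, to one of at most `2^c` sets, then
there is a protocol of `c` bits whose error set has measure at most `δ` under the product of the
marginals. -/
lemma exists_protocol_of_net {f : X × Y → Bool} {μ : X × Y → ℝ} (hμ : μ ∈ stdSimplex ℝ (X × Y))
    {c : ℕ} {δ : ℝ} {G : Finset (Finset Y)} (hG : #G ≤ 2 ^ c)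
    (hnet : ∀ g ∈ rowFamily f, ∃ h ∈ G, ∑ y ∈ symmDiff g h, ∑ x, μ (x, y) ≤ δ) :
    ∃ P : Protocol X Y c, ∑ z : X × Y with P.output (P.message z.1) z.2 ≠ f z,
      (∑ y, μ (z.1, y)) * (∑ x, μ (x, z.2)) ≤ δ := by
  classical
  obtain ⟨e⟩ : Nonempty (G ↪ (Fin c → Bool)) :=
    Function.Embedding.nonempty_of_card_le (by simpa using hG)
  have hx : ∀ x, ∃ h : G, ∑ y ∈ symmDiff (Finset.univ.filter fun y => f (x, y) = true) h.1,
      ∑ x, μ (x, y) ≤ δ := fun x => by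
    obtain ⟨h, hh, hle⟩ := hnet _ (Finset.mem_image_of_mem _ (Finset.mem_univ x))
    exact ⟨⟨h, hh⟩, hle⟩
  choose r hr using hx
  refine ⟨⟨fun x => e (r x), fun w y => decide (∃ g : G, e g = w ∧ y ∈ g.1)⟩, ?_⟩
  have hout : ∀ x y, (decide (∃ g : G, e g = e (r x) ∧ y ∈ g.1) ≠ f (x, y)) ↔
      y ∈ symmDiff (Finset.univ.filter fun y => f (x, y) = true) (r x).1 := by
    intro x y
    have h1 : (∃ g : G, e g = e (r x) ∧ y ∈ g.1) ↔ y ∈ (r x).1 := by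
      simp only [e.injective.eq_iff]
      exact ⟨fun ⟨g, hg, hy⟩ => hg ▸ hy, fun h => ⟨_, rfl, h⟩⟩
    have h2 : decide (∃ g : G, e g = e (r x) ∧ y ∈ g.1) = decide (y ∈ (r x).1) :=
      decide_eq_decide.2 h1
    rw [h2, Finset.mem_symmDiff, Finset.mem_filter]
    cases f (x, y) <;> simp
  rw [Finset.sum_filter, Fintype.sum_prod_type]
  calc ∑ x, ∑ y, (if decide (∃ g : G, e g = e (r x) ∧ y ∈ g.1) ≠ f (x, y) then
        (∑ y, μ (x, y)) * (∑ x, μ (x, y)) else 0)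
      = ∑ x, (∑ y, μ (x, y)) *
        ∑ y ∈ symmDiff (Finset.univ.filter fun y => f (x, y) = true) (r x).1, ∑ x, μ (x, y) := by
        refine Finset.sum_congr rfl fun x _ => ?_
        simp only [hout]
        rw [Finset.sum_ite_mem, Finset.univ_inter, Finset.mul_sum]
    _ ≤ ∑ x, (∑ y, μ (x, y)) * δ := Finset.sum_le_sum fun x _ =>
        mul_le_mul_of_nonneg_left (hr x) (Finset.sum_nonneg fun _ _ => hμ.1 _)
    _ = δ := by rw [← Finset.sum_mul, sum_fst_marginal, hμ.2, one_mul]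

/-- The choice of `t` makes `(I + 1) / t` equal to `ε`. Since `ε < 1/2`, `t > 2`; this gives `n ≥ 3`
and the constant, by `3 * n + 2 < 3 * t + 5 < 7 * t`. -/
lemma complexity_le_of_mutualInfo (f : X × Y → Bool) {μ : X × Y → ℝ}
    (hμ : μ ∈ stdSimplex ℝ (X × Y)) {ε : ℝ} (hε : 0 < ε) (hε2 : ε < 1 / 2) :
    (complexity ε μ f : ℝ) ≤ 7 * ((mutualInfo μ + 1) / ε) * vcDimension f := by
  rcases Nat.eq_zero_or_pos (vcDimension f) with hd | hd
  · simp [complexity_eq_zero_of_vcDimension_eq_zero hε.le μ f hd, hd]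
  have hI := mutualInfo_nonneg hμ
  set t := (mutualInfo μ + 1) / ε with ht
  have ht2 : 2 < t := by
    rw [ht, lt_div_iff₀ hε]
    linarith
  have hν : (fun y => ∑ x, μ (x, y)) ∈ stdSimplex ℝ Y :=
    ⟨fun y => Finset.sum_nonneg fun _ _ => hμ.1 _, by rw [sum_snd_marginal, hμ.2]⟩
  set n := ⌈t⌉₊ with hn
  have htn : t ≤ n := Nat.le_ceil t
  have hnt : (n : ℝ) < t + 1 := Nat.ceil_lt_add_one (by linarith)
  have hn3 : 3 ≤ n := by
    have : (2 : ℝ) < n := ht2.trans_le htn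
    exact_mod_cast this
  obtain ⟨G, hG, hnet⟩ := exists_net hν hd hn3 (F := rowFamily f) le_rfl
  have hpow : (4 * 8 ^ n) ^ vcDimension f = 2 ^ ((3 * n + 2) * vcDimension f) := by
    rw [pow_mul, pow_add, pow_mul]
    norm_num [mul_comm]
  obtain ⟨P, hP⟩ := exists_protocol_of_net hμ (hG.trans_eq hpow) hnet
  have hδ : (1 / 2 : ℝ) ^ n ≤ 2 ^ (-t) := by
    rw [one_div, inv_pow, ← Real.rpow_natCast, ← Real.rpow_neg (by norm_num)]
    exact Real.rpow_le_rpow_of_exponent_le (by norm_num) (by linarith)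
  have herr : P.error f μ ≤ ε := by
    have h := mul_sum_le_mutualInfo_add_one hμ _ t (hP.trans hδ)
    have e : mutualInfo μ + 1 = t * ε := by rw [ht]; field_simp
    rw [e] at h
    exact le_of_mul_le_mul_left h (by linarith)
  have hc : (complexity ε μ f : ℝ) ≤ (3 * n + 2) * vcDimension f := by
    exact_mod_cast complexity_le P herr
  refine hc.trans (mul_le_mul_of_nonneg_right ?_ (Nat.cast_nonneg _))
  linarith

/-- A weakening of the previous bound, since `1 / ε` and its logarithm are both at least one. -/
lemma complexity_le_of_mutualInfo_log (f : X × Y → Bool) {μ : X × Y → ℝ}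
    (hμ : μ ∈ stdSimplex ℝ (X × Y)) {ε : ℝ} (hε : 0 < ε) (hε2 : ε < 1 / 2) :
    (complexity ε μ f : ℝ) ≤ 7 * (1 / ε * Real.logb 2 (1 / ε)) *
      (1 / ε * mutualInfo μ + 1) * vcDimension f := by
  refine (complexity_le_of_mutualInfo f hμ hε hε2).trans
    (mul_le_mul_of_nonneg_right ?_ (Nat.cast_nonneg _))
  have hI := mutualInfo_nonneg hμ
  have h2 : 2 ≤ 1 / ε := by
    rw [le_div_iff₀ hε]
    linarith
  have hlog : 1 ≤ Real.logb 2 (1 / ε) := by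
    rw [Real.le_logb_iff_rpow_le (by norm_num) (by positivity), Real.rpow_one]
    exact h2
  have hl : 1 / ε ≤ 1 / ε * Real.logb 2 (1 / ε) :=
    le_mul_of_one_le_right (by linarith) hlog
  have hi : mutualInfo μ + 1 ≤ 1 / ε * mutualInfo μ + 1 := by nlinarith
  calc 7 * ((mutualInfo μ + 1) / ε) = 7 * (1 / ε) * (mutualInfo μ + 1) := by ring
    _ ≤ 7 * (1 / ε * Real.logb 2 (1 / ε)) * (1 / ε * mutualInfo μ + 1) :=
      mul_le_mul (by linarith) hi (by linarith) (by linarith)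

end Protocols

end OneWayCC

theorem mainTheorem1 :
    (∃ κ : ℝ, 0 < κ ∧
      ∀ (X : Type u) (Y : Type v) [Fintype X] [Fintype Y] [DecidableEq Y]
        (f : X × Y → Bool) (μ : X × Y → ℝ), μ ∈ stdSimplex ℝ (X × Y) →
        ∀ ε : ℝ, 0 < ε → ε < 1 / 2 →
          (OneWayCC.complexity ε μ f : ℝ) ≤
            κ * (1 / ε * Real.logb 2 (1 / ε)) *
              (1 / ε * OneWayCC.mutualInfo μ + 1) * OneWayCC.vcDimension f) ∧
    (∀ ε : ℝ, 0 < ε → ε < 1 / 2 → ∃ C : ℝ, 0 < C ∧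
      ∀ (X : Type u) (Y : Type v) [Fintype X] [Fintype Y] [DecidableEq Y]
        (f : X × Y → Bool) (μ : X × Y → ℝ), μ ∈ stdSimplex ℝ (X × Y) →
          (OneWayCC.complexity ε μ f : ℝ) ≤
            C * (OneWayCC.mutualInfo μ + 1) * OneWayCC.vcDimension f) := by
  refine ⟨⟨7, by norm_num, fun X Y _ _ _ f μ hμ ε hε hε2 =>
    OneWayCC.complexity_le_of_mutualInfo_log f hμ hε hε2⟩, fun ε hε hε2 =>
    ⟨7 / ε, by positivity, fun X Y _ _ _ f μ hμ => ?_⟩⟩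
  refine (OneWayCC.complexity_le_of_mutualInfo f hμ hε hε2).trans_eq ?_
  ring
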